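/- Let $K$ be an algebraically closed field of characteristic zero, let $s\ge 1$, let $S=K[t_1,\dots,t_s]$ with the standard grading $\deg(t_i)=1$, and let $I\subset S$ be a graded ideal such that the Krull dimension of $S/I$ is $1$. Call $I$ a lattice ideal if $I$ is generated by binomials $t^a-t^b$ with $a,b\in\mathbb{N}^s$ and, for every $i$, $t_i$ is not a zero-divisor of $S/I$. Let $T=\{[(x_1,\dots,x_s)]\in\mathbb{P}^{s-1}_K \mid x_i\neq 0 \text{ for all } i\}$ be the projective torus, a group under componentwise multiplication. For $\mathbb{Y}\subset\mathbb{P}^{s-1}_K$ let $I(\mathbb{Y})$ be the ideal of $S$ generated by the homogeneous polynomials that vanish at all points of $\mathbb{Y}$. Then $I$ is a lattice ideal if and only if there is a finite subgroup $\mathbb{Y}$ of $T$ such that $I=I(\mathbb{Y})$. -/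

import Mathlib

namespace LatticeDimOne

open MvPolynomial LinearAlgebra.Projectivization

/-- The projective space `ℙ^{s-1}` over `K`, the space of lines of `K^s`. -/
abbrev ProjSpace (K : Type*) [Field K] (s : ℕ) : Type _ := ℙ K (Fin s → K)

/-- The vanishing ideal `I(Y)` of a set `Y` of projective points: the ideal generated by the
homogeneous polynomials that vanish at all points `[α]` of `Y`. -/
noncomputable def vanishingIdeal {K : Type*} [Field K] {s : ℕ} (Y : Set (ProjSpace K s)) :
    Ideal (MvPolynomial (Fin s) K) :=
  Ideal.span {f | (∃ d : ℕ, f.IsHomogeneous d) ∧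
    ∀ (α : Fin s → K) (hα : α ≠ 0), Projectivization.mk K α hα ∈ Y → eval α f = 0}

/-- A binomial is a difference `t^a - t^b` of two monomials. -/
def IsBinomial {K : Type*} [Field K] {s : ℕ} (f : MvPolynomial (Fin s) K) : Prop :=
  ∃ a b : Fin s →₀ ℕ, f = monomial a 1 - monomial b 1

/-- A binomial ideal is an ideal generated by binomials. -/
def IsBinomialIdeal {K : Type*} [Field K] {s : ℕ} (I : Ideal (MvPolynomial (Fin s) K)) : Prop :=
  ∃ B : Set (MvPolynomial (Fin s) K), (∀ f ∈ B, IsBinomial f) ∧ I = Ideal.span B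

/-- A lattice ideal is a binomial ideal `I` such that no variable `t_i` is a zero-divisor
of `S/I`. -/
def IsLatticeIdeal {K : Type*} [Field K] {s : ℕ} (I : Ideal (MvPolynomial (Fin s) K)) : Prop :=
  IsBinomialIdeal I ∧
    ∀ i : Fin s, Ideal.Quotient.mk I (X i) ∈ nonZeroDivisors (MvPolynomial (Fin s) K ⧸ I)

/-- The projective torus in `ℙ^{s-1}`: the points `[(x_1, …, x_s)]` with all `x_i` nonzero. -/
def projectiveTorus (K : Type*) [Field K] (s : ℕ) : Set (ProjSpace K s) :=
  {p | ∃ (x : Fin s → K) (hx : x ≠ 0), (∀ i, x i ≠ 0) ∧ p = Projectivization.mk K x hx}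

section Torus

variable {K : Type*} [Field K] {s : ℕ}

theorem rep_apply_ne_zero (p : projectiveTorus K s) (i : Fin s) : p.1.rep i ≠ 0 := by
  obtain ⟨p, x, hx, h, rfl⟩ := p
  obtain ⟨a, ha⟩ := Projectivization.exists_smul_eq_mk_rep K x hx
  show (Projectivization.mk K x hx).rep i ≠ 0
  rw [← ha]
  simpa [Units.smul_def] using h i

variable [NeZero s]

theorem ne_zero_of_apply_ne_zero {x : Fin s → K} (h : ∀ i, x i ≠ 0) : x ≠ 0 :=
  fun h0 => h 0 (by simp [h0])

/-- The point `[x]` of the projective torus given by a vector `x` with nonzero coordinates. -/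
def torusMk (x : Fin s → K) (h : ∀ i, x i ≠ 0) : projectiveTorus K s :=
  ⟨Projectivization.mk K x (ne_zero_of_apply_ne_zero h), x, ne_zero_of_apply_ne_zero h, h, rfl⟩

theorem torusMk_eq_iff {x y : Fin s → K} (hx : ∀ i, x i ≠ 0) (hy : ∀ i, y i ≠ 0) :
    torusMk x hx = torusMk y hy ↔ ∃ c : K, ∀ i, c * y i = x i := by
  rw [Subtype.ext_iff]
  exact (Projectivization.mk_eq_mk_iff' K x y _ _).trans (exists_congr fun c => funext_iff)

theorem torusMk_rep (p : projectiveTorus K s) :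
    torusMk p.1.rep (rep_apply_ne_zero p) = p :=
  Subtype.ext (Projectivization.mk_rep p.1)

theorem exists_torusMk (p : projectiveTorus K s) :
    ∃ (x : Fin s → K) (h : ∀ i, x i ≠ 0), torusMk x h = p :=
  ⟨_, _, torusMk_rep p⟩

theorem exists_rep_torusMk (x : Fin s → K) (h : ∀ i, x i ≠ 0) :
    ∃ c : K, ∀ i, c * x i = (torusMk x h).1.rep i :=
  (torusMk_eq_iff (rep_apply_ne_zero _) h).1 (torusMk_rep _)

/-- Componentwise multiplication `[x] * [y] = [x * y]` (see `torusMk_mul`). -/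
noncomputable instance : Mul (projectiveTorus K s) :=
  ⟨fun p q => torusMk (fun i => p.1.rep i * q.1.rep i)
    fun i => mul_ne_zero (rep_apply_ne_zero p i) (rep_apply_ne_zero q i)⟩

/-- The identity is `[(1, …, 1)]`. -/
instance : One (projectiveTorus K s) := ⟨torusMk (fun _ => 1) fun _ => one_ne_zero⟩

/-- Componentwise inversion `[x]⁻¹ = [x⁻¹]` (see `torusMk_inv`). -/
noncomputable instance : Inv (projectiveTorus K s) :=
  ⟨fun p => torusMk (fun i => (p.1.rep i)⁻¹) fun i => inv_ne_zero (rep_apply_ne_zero p i)⟩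

theorem torusMk_mul (x y : Fin s → K) (hx : ∀ i, x i ≠ 0) (hy : ∀ i, y i ≠ 0) :
    torusMk x hx * torusMk y hy =
      torusMk (fun i => x i * y i) fun i => mul_ne_zero (hx i) (hy i) := by
  obtain ⟨c, hc⟩ := exists_rep_torusMk x hx
  obtain ⟨d, hd⟩ := exists_rep_torusMk y hy
  refine (torusMk_eq_iff _ _).2 ⟨c * d, fun i => ?_⟩
  rw [← hc, ← hd]
  ring

theorem torusMk_one : torusMk (fun _ => (1 : K)) (fun _ => one_ne_zero) =
    (1 : projectiveTorus K s) := rfl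

theorem torusMk_inv (x : Fin s → K) (hx : ∀ i, x i ≠ 0) :
    (torusMk x hx)⁻¹ = torusMk (fun i => (x i)⁻¹) fun i => inv_ne_zero (hx i) := by
  obtain ⟨c, hc⟩ := exists_rep_torusMk x hx
  refine (torusMk_eq_iff _ _).2 ⟨c⁻¹, fun i => ?_⟩
  rw [← hc, mul_inv]

/-- The projective torus is an abelian group under componentwise multiplication. -/
noncomputable instance : CommGroup (projectiveTorus K s) where
  mul_assoc p q r := by
    obtain ⟨x, hx, rfl⟩ := exists_torusMk p
    obtain ⟨y, hy, rfl⟩ := exists_torusMk q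
    obtain ⟨z, hz, rfl⟩ := exists_torusMk r
    simp only [torusMk_mul, mul_assoc]
  one_mul p := by
    obtain ⟨x, hx, rfl⟩ := exists_torusMk p
    simp only [← torusMk_one, torusMk_mul, one_mul]
  mul_one p := by
    obtain ⟨x, hx, rfl⟩ := exists_torusMk p
    simp only [← torusMk_one, torusMk_mul, mul_one]
  inv_mul_cancel p := by
    obtain ⟨x, hx, rfl⟩ := exists_torusMk p
    simp only [← torusMk_one, torusMk_mul, torusMk_inv, inv_mul_cancel₀ (hx _)]
  mul_comm p q := by
    obtain ⟨x, hx, rfl⟩ := exists_torusMk p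
    obtain ⟨y, hy, rfl⟩ := exists_torusMk q
    simp only [torusMk_mul, mul_comm]

end Torus

end LatticeDimOne

attribute [local instance] MvPolynomial.gradedAlgebra

/-!
Let `coord i p` be the `i`-th coordinate of a torus point `p`, normalised by `coord 0 p = 1`. For an
exponent `a`, the value of `t^a` at the normalised point is a multiplicative character
`monomialHom a` of the torus.

For a subgroup `Y` of the torus, Dedekind's theorem on the linear independence of characters shows
that a homogeneous polynomial vanishing on `Y` is a linear combination of binomials `t^a - t^b` with
`monomialHom a = monomialHom b` on `Y` (`mem_of_sum_smul_monoidHom_eq_zero`,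
`vanishingIdeal_le_of_binomials`). So `I(Y)` is a binomial ideal, and variables are regular modulo
it because no coordinate of a torus point vanishes. This gives `isLatticeIdeal_vanishingIdeal`.

Conversely, let `I` be a graded lattice ideal with `dim S/I = 1`. The exponent differences `a - b` of
the binomials `t^a - t^b ∈ I` form a lattice `L ⊆ ℤ^s`; as the variables are regular modulo `I`, a
binomial lies in `I` exactly when its exponent difference lies in `L`, and as `I` is graded and
proper, `L` lies in the hyperplane of vectors of coordinate sum `0`. Let `G = ℤ^s / (L + ℤ e_0)`.
It is finite: otherwise there is a nonzero `w : ℤ^s → ℤ` killing `L` and `e_0`, and after a shift by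
a constant vector the map `t_k ↦ z λ^{w_k}` produces a chain of three primes containing `I`
(`two_le_ringKrullDim_of_weight`), so that `dim S/I ≥ 2`. A character `χ` of `G` yields the torus
point `[χ(e_0) : ⋯ : χ(e_{s-1})]`, and these points form a finite subgroup `Y`. As characters
separate the points of `G`, the ideals `I(Y)` and `I` contain the same homogeneous binomials. Both
are generated by these, hence they are equal.
-/

namespace LatticeDimOne

open MvPolynomial

/-! ### Linear independence of characters -/

/-- If a polynomial becomes zero after each monomial `t^a` is replaced by a character `ψ a`, then by
linear independence of characters the coefficients over each fibre of `ψ` add up to zero, so the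
polynomial is a combination of binomials `t^a - t^b` with `ψ a = ψ b`. -/
theorem mem_of_sum_smul_monoidHom_eq_zero {K σ G : Type*} [Field K] [Monoid G]
    (f : MvPolynomial σ K) (ψ : (σ →₀ ℕ) → (G →* K)) (J : Ideal (MvPolynomial σ K))
    (hJ : ∀ a ∈ f.support, ∀ b ∈ f.support, ψ a = ψ b →
      (monomial a 1 - monomial b 1 : MvPolynomial σ K) ∈ J)
    (hf : ∑ a ∈ f.support, coeff a f • (ψ a : G → K) = 0) : f ∈ J := by
  classical
  have hli := linearIndependent_monoidHom G K
  rw [linearIndependent_iff] at hli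
  have hsum : ∑ a ∈ f.support, Finsupp.single (ψ a) (coeff a f) = 0 :=
    hli _ (by simpa [map_sum, Finsupp.linearCombination_single] using hf)
  -- `v φ` is the common class modulo `J` of all monomials of `f` whose character is `φ`.
  let v : (G →* K) → MvPolynomial σ K ⧸ J := fun φ =>
    if h : ∃ a ∈ f.support, ψ a = φ then Ideal.Quotient.mk J (monomial h.choose 1) else 0
  have hv : ∀ a ∈ f.support, v (ψ a) = Ideal.Quotient.mk J (monomial a 1) := by
    intro a ha
    have h : ∃ b ∈ f.support, ψ b = ψ a := ⟨a, ha, rfl⟩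
    simp only [v, dif_pos h]
    exact Ideal.Quotient.eq.2 (hJ _ h.choose_spec.1 a ha h.choose_spec.2)
  have h0 := congrArg (Finsupp.linearCombination K v) hsum
  rw [map_sum, map_zero] at h0
  rw [← Ideal.Quotient.eq_zero_iff_mem, ← h0, f.as_sum, map_sum, ← f.as_sum]
  refine Finset.sum_congr rfl fun a ha => ?_
  rw [Finsupp.linearCombination_single, hv a ha, ← Ideal.Quotient.mkₐ_eq_mk K, ← map_smul,
    smul_monomial, smul_eq_mul, mul_one]

theorem eval_smul_of_isHomogeneous {K σ : Type*} [CommRing K] {f : MvPolynomial σ K} {d : ℕ}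
    (hf : f.IsHomogeneous d) (c : K) (x : σ → K) :
    eval (fun i => c * x i) f = c ^ d * eval x f := by
  rw [eval_eq, eval_eq, Finset.mul_sum]
  refine Finset.sum_congr rfl fun a ha => ?_
  have hdeg : a.degree = d := by
    rw [Finsupp.degree_eq_weight_one]
    exact hf (mem_support_iff.1 ha)
  rw [Finsupp.degree_apply] at hdeg
  simp only [mul_pow, Finset.prod_mul_distrib, Finset.prod_pow_eq_pow_sum]
  rw [hdeg]
  ring

variable {K : Type*} [Field K] {s : ℕ}

theorem eval_eq_zero_of_mem_vanishingIdeal {Y : Set (ProjSpace K s)}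
    {f : MvPolynomial (Fin s) K} (hf : f ∈ vanishingIdeal Y) {α : Fin s → K} (hα : α ≠ 0)
    (hY : Projectivization.mk K α hα ∈ Y) : eval α f = 0 := by
  have : vanishingIdeal Y ≤ RingHom.ker (eval α) :=
    Ideal.span_le.2 fun g hg => hg.2 α hα hY
  exact this hf

theorem isHomogeneous_vanishingIdeal (Y : Set (ProjSpace K s)) :
    (vanishingIdeal Y).IsHomogeneous (homogeneousSubmodule (Fin s) K) :=
  Ideal.homogeneous_span _ _ fun _ hf => hf.1

theorem isHomogeneous_binomial {a b : Fin s →₀ ℕ} (h : a.degree = b.degree) :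
    (monomial a 1 - monomial b 1 : MvPolynomial (Fin s) K).IsHomogeneous a.degree :=
  (isHomogeneous_monomial _ rfl).sub (isHomogeneous_monomial _ h.symm)

/-! ### Vanishing ideals of subgroups of the torus -/

section

variable [NeZero s]

/-- The `i`-th coordinate of a torus point, normalised so that the coordinate of index `0` is `1`.
It does not depend on the representative, and is multiplicative in the point. -/
noncomputable def coord (i : Fin s) : projectiveTorus K s →* K where
  toFun p := p.1.rep i / p.1.rep 0
  map_one' := by
    obtain ⟨c, hc⟩ := exists_rep_torusMk (fun _ : Fin s => (1 : K)) fun _ => one_ne_zero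
    rw [torusMk_one] at hc
    have h0 := rep_apply_ne_zero (1 : projectiveTorus K s) 0
    rw [← hc, ← hc]
    rw [← hc] at h0
    exact div_self h0
  map_mul' p q := by
    obtain ⟨c, hc⟩ := exists_rep_torusMk (fun i => p.1.rep i * q.1.rep i)
      fun i => mul_ne_zero (rep_apply_ne_zero p i) (rep_apply_ne_zero q i)
    have h0 := rep_apply_ne_zero (p * q) 0
    change ∀ i, _ = (p * q).1.rep i at hc
    rw [← hc] at h0 ⊢
    rw [← hc, mul_div_mul_left _ _ (left_ne_zero_of_mul h0), mul_div_mul_comm]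

theorem coord_torusMk (x : Fin s → K) (hx : ∀ i, x i ≠ 0) (i : Fin s) :
    coord i (torusMk x hx) = x i / x 0 := by
  obtain ⟨c, hc⟩ := exists_rep_torusMk x hx
  have h0 := rep_apply_ne_zero (torusMk x hx) 0
  change (torusMk x hx).1.rep i / (torusMk x hx).1.rep 0 = _
  rw [← hc] at h0 ⊢
  rw [← hc, mul_div_mul_left _ _ (left_ne_zero_of_mul h0)]

theorem coord_ne_zero (p : projectiveTorus K s) (i : Fin s) : coord i p ≠ 0 :=
  div_ne_zero (rep_apply_ne_zero p i) (rep_apply_ne_zero p 0)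

theorem torusMk_coord (p : projectiveTorus K s) :
    torusMk (fun i => coord i p) (coord_ne_zero p) = p := by
  conv_rhs => rw [← torusMk_rep p]
  exact (torusMk_eq_iff _ _).2 ⟨(p.1.rep 0)⁻¹, fun i => inv_mul_eq_div _ _⟩

theorem eval_eq_zero_of_eval_coord_eq_zero {f : MvPolynomial (Fin s) K} {d : ℕ}
    (hf : f.IsHomogeneous d) {p : projectiveTorus K s} (h : eval (fun i => coord i p) f = 0)
    {α : Fin s → K} (hα : α ≠ 0) (hp : Projectivization.mk K α hα = p.1) : eval α f = 0 := by
  obtain ⟨c, hc⟩ := (Projectivization.mk_eq_mk_iff' K _ _ _ _).1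
    (hp.trans (congrArg Subtype.val (torusMk_coord p)).symm)
  rw [← hc]
  change eval (fun i => c * coord i p) f = 0
  rw [eval_smul_of_isHomogeneous hf, h, mul_zero]

theorem mem_vanishingIdeal_of_eval_coord {Y : Set (projectiveTorus K s)}
    {f : MvPolynomial (Fin s) K} {d : ℕ} (hf : f.IsHomogeneous d)
    (h : ∀ p ∈ Y, eval (fun i => coord i p) f = 0) : f ∈ vanishingIdeal (Subtype.val '' Y) := by
  refine Ideal.subset_span ⟨⟨d, hf⟩, fun α hα ⟨p, hp, hpα⟩ => ?_⟩
  exact eval_eq_zero_of_eval_coord_eq_zero hf (h p hp) hα hpα.symm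

theorem eval_coord_eq_zero_of_mem_vanishingIdeal {Y : Set (projectiveTorus K s)}
    {f : MvPolynomial (Fin s) K} (hf : f ∈ vanishingIdeal (Subtype.val '' Y))
    {p : projectiveTorus K s} (hp : p ∈ Y) : eval (fun i => coord i p) f = 0 :=
  eval_eq_zero_of_mem_vanishingIdeal hf (ne_zero_of_apply_ne_zero (coord_ne_zero p))
    ⟨p, hp, (congrArg Subtype.val (torusMk_coord p)).symm⟩

/-- The character of the torus given by the value of the monomial `t^a` at the normalised
representative of a point. -/
noncomputable def monomialHom (a : Fin s →₀ ℕ) : projectiveTorus K s →* K :=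
  ∏ i, coord i ^ a i

theorem monomialHom_apply (a : Fin s →₀ ℕ) (p : projectiveTorus K s) :
    monomialHom a p = ∏ i, coord i p ^ a i := by
  simp [monomialHom, MonoidHom.finsetProd_apply]

theorem eval_coord_monomial (a : Fin s →₀ ℕ) (c : K) (p : projectiveTorus K s) :
    eval (fun i => coord i p) (monomial a c) = c * monomialHom a p := by
  rw [eval_monomial, monomialHom_apply, Finsupp.prod_fintype _ _ fun _ => pow_zero _]

theorem binomial_mem_vanishingIdeal_iff (Y : Subgroup (projectiveTorus K s))
    {a b : Fin s →₀ ℕ} (h : a.degree = b.degree) :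
    (monomial a 1 - monomial b 1 : MvPolynomial (Fin s) K) ∈
      vanishingIdeal (Subtype.val '' (Y : Set (projectiveTorus K s))) ↔
      ∀ p ∈ Y, monomialHom (K := K) a p = monomialHom b p := by
  have key : ∀ p : projectiveTorus K s, eval (fun i => coord i p)
      (monomial a 1 - monomial b 1 : MvPolynomial (Fin s) K) = 0 ↔
      monomialHom (K := K) a p = monomialHom b p := fun p => by
    rw [map_sub, eval_coord_monomial, eval_coord_monomial, one_mul, one_mul, sub_eq_zero]
  exact ⟨fun hm p hp => (key p).1 (eval_coord_eq_zero_of_mem_vanishingIdeal hm hp),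
    fun hm => mem_vanishingIdeal_of_eval_coord (isHomogeneous_binomial h)
      fun p hp => (key p).2 (hm p hp)⟩

/-- The vanishing ideal of a subgroup of the torus is generated by the homogeneous binomials it
contains. -/
theorem vanishingIdeal_le_of_binomials (Y : Subgroup (projectiveTorus K s))
    {J : Ideal (MvPolynomial (Fin s) K)}
    (hJ : ∀ a b : Fin s →₀ ℕ, a.degree = b.degree →
      (monomial a 1 - monomial b 1 : MvPolynomial (Fin s) K) ∈
        vanishingIdeal (Subtype.val '' (Y : Set (projectiveTorus K s))) →
      (monomial a 1 - monomial b 1 : MvPolynomial (Fin s) K) ∈ J) :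
    vanishingIdeal (Subtype.val '' (Y : Set (projectiveTorus K s))) ≤ J := by
  refine Ideal.span_le.2 fun f hf => ?_
  have hmem := Ideal.subset_span hf
  obtain ⟨⟨d, hd⟩, -⟩ := hf
  have hdeg : ∀ a ∈ f.support, a.degree = d := fun a ha => by
    rw [Finsupp.degree_eq_weight_one]
    exact hd (mem_support_iff.1 ha)
  refine mem_of_sum_smul_monoidHom_eq_zero f
    (fun a => (monomialHom a).comp Y.subtype) J (fun a ha b hb hab => ?_) ?_
  · have h : a.degree = b.degree := (hdeg a ha).trans (hdeg b hb).symm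
    exact hJ a b h ((binomial_mem_vanishingIdeal_iff Y h).2
      fun p hp => DFunLike.congr_fun hab ⟨p, hp⟩)
  · ext p
    have h := eval_coord_eq_zero_of_mem_vanishingIdeal hmem p.2
    rw [f.as_sum, map_sum] at h
    simpa [eval_coord_monomial] using h

theorem isLatticeIdeal_vanishingIdeal (Y : Subgroup (projectiveTorus K s)) :
    IsLatticeIdeal (vanishingIdeal (Subtype.val '' (Y : Set (projectiveTorus K s)))) := by
  set J := vanishingIdeal (Subtype.val '' (Y : Set (projectiveTorus K s))) with hJdef
  have hhom : J.IsHomogeneous (homogeneousSubmodule (Fin s) K) := isHomogeneous_vanishingIdeal _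
  refine ⟨⟨{f | IsBinomial f ∧ f ∈ J}, fun f hf => hf.1, le_antisymm ?_ ?_⟩, fun i => ?_⟩
  · exact vanishingIdeal_le_of_binomials Y fun a b _ hab => Ideal.subset_span ⟨⟨a, b, rfl⟩, hab⟩
  · exact Ideal.span_le.2 fun f hf => hf.2
  · rw [mem_nonZeroDivisors_iff_left]
    intro q hq
    obtain ⟨f, rfl⟩ := Ideal.Quotient.mk_surjective q
    rw [← map_mul, Ideal.Quotient.eq_zero_iff_mem] at hq
    rw [Ideal.Quotient.eq_zero_iff_mem, hhom.mem_iff]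
    intro d
    refine mem_vanishingIdeal_of_eval_coord (d := d)
      ((mem_homogeneousSubmodule _ _).1 (SetLike.coe_mem _)) fun p hp => ?_
    have h := hhom (1 + d) hq
    rw [DirectSum.coe_decompose_mul_add_of_left_mem _
      ((mem_homogeneousSubmodule _ _).2 (isHomogeneous_X K i))] at h
    have h' := eval_coord_eq_zero_of_mem_vanishingIdeal h hp
    rw [map_mul, eval_X] at h'
    exact (mul_eq_zero.1 h').resolve_left (coord_ne_zero p i)

end

/-! ### A lower bound for the dimension -/

theorem two_le_ringKrullDim_quotient {R : Type*} [CommRing R] {I P₀ P₁ P₂ : Ideal R}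
    [P₀.IsPrime] [P₁.IsPrime] [P₂.IsPrime] (h : I ≤ P₀) (h₀₁ : P₀ < P₁) (h₁₂ : P₁ < P₂) :
    2 ≤ ringKrullDim (R ⧸ I) := by
  rw [ringKrullDim_quotient]
  let p : LTSeries (PrimeSpectrum.zeroLocus (I : Set R)) :=
    { length := 2
      toFun := ![⟨⟨P₀, inferInstance⟩, h⟩, ⟨⟨P₁, inferInstance⟩, h.trans h₀₁.le⟩,
        ⟨⟨P₂, inferInstance⟩, h.trans (h₀₁.le.trans h₁₂.le)⟩]
      step := fun i => by
        fin_cases i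
        · exact h₀₁
        · exact h₁₂ }
  exact Order.LTSeries.length_le_krullDim p

/-- If the binomials generating `I` are homogeneous both for the standard grading and for a
nonconstant weight `v` with minimum `0`, then the kernel of `t_k ↦ z λ^{v k}` and those of its
specialisations `λ = 0` and `z = λ = 0` form a chain of three primes above `I`. -/
theorem two_le_ringKrullDim_of_weight {I : Ideal (MvPolynomial (Fin s) K)} (v : Fin s → ℕ)
    {i j : Fin s} (hi : v i = 0) (hj : v j ≠ 0) {B : Set (MvPolynomial (Fin s) K)}
    (hIB : I = Ideal.span B)
    (hB : ∀ f ∈ B, ∃ a b : Fin s →₀ ℕ, f = monomial a 1 - monomial b 1 ∧ a.degree = b.degree ∧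
      ∑ k, a k * v k = ∑ k, b k * v k) :
    2 ≤ ringKrullDim (MvPolynomial (Fin s) K ⧸ I) := by
  let φ₀ : MvPolynomial (Fin s) K →ₐ[K] Polynomial (Polynomial K) :=
    MvPolynomial.aeval fun k => Polynomial.C Polynomial.X * Polynomial.X ^ v k
  let φ₁ : MvPolynomial (Fin s) K →ₐ[K] Polynomial K :=
    MvPolynomial.aeval fun k => Polynomial.X * 0 ^ v k
  let φ₂ : MvPolynomial (Fin s) K →ₐ[K] K := MvPolynomial.aeval fun _ => 0
  have h₁ : ∀ f, φ₁ f = Polynomial.eval 0 (φ₀ f) := by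
    intro f
    have : φ₁ = ((Polynomial.aeval (0 : Polynomial K)).restrictScalars K).comp φ₀ := by
      ext k
      simp [φ₁, φ₀]
    rw [this]
    simp
  have h₂ : ∀ f, φ₂ f = Polynomial.eval 0 (φ₁ f) := by
    intro f
    have : φ₂ = (Polynomial.aeval (0 : K)).comp φ₁ := by
      ext k
      simp [φ₂, φ₁]
    rw [this]
    simp
  have hφ₀ : ∀ a : Fin s →₀ ℕ, φ₀ (monomial a 1) =
      Polynomial.C Polynomial.X ^ a.degree * Polynomial.X ^ ∑ k, a k * v k := by
    intro a
    simp only [φ₀, MvPolynomial.aeval_monomial, map_one, one_mul]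
    rw [Finsupp.prod_fintype _ _ fun _ => pow_zero _, Finsupp.degree_eq_sum]
    simp only [mul_pow, ← pow_mul, Finset.prod_mul_distrib, Finset.prod_pow_eq_pow_sum,
      mul_comm (v _)]
  have : (RingHom.ker φ₀).IsPrime := RingHom.ker_isPrime φ₀
  have : (RingHom.ker φ₁).IsPrime := RingHom.ker_isPrime φ₁
  have : (RingHom.ker φ₂).IsPrime := RingHom.ker_isPrime φ₂
  refine two_le_ringKrullDim_quotient (P₀ := RingHom.ker φ₀) (P₁ := RingHom.ker φ₁)
    (P₂ := RingHom.ker φ₂) ?_ ?_ ?_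
  · rw [hIB, Ideal.span_le]
    intro f hf
    obtain ⟨a, b, rfl, hd, hv⟩ := hB f hf
    change φ₀ _ = 0
    rw [map_sub, hφ₀, hφ₀, hd, hv, sub_self]
  · refine lt_of_le_of_ne (fun f hf => ?_) fun h => ?_
    · rw [RingHom.mem_ker] at hf ⊢
      rw [h₁, hf, Polynomial.eval_zero]
    · have : (X j : MvPolynomial (Fin s) K) ∈ RingHom.ker φ₀ := by
        rw [h, RingHom.mem_ker]
        simp [φ₁, hj]
      simp [RingHom.mem_ker, φ₀] at this
  · refine lt_of_le_of_ne (fun f hf => ?_) fun h => ?_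
    · rw [RingHom.mem_ker] at hf ⊢
      rw [h₂, hf, Polynomial.eval_zero]
    · have : (X i : MvPolynomial (Fin s) K) ∈ RingHom.ker φ₁ := by
        rw [h, RingHom.mem_ker]
        simp [φ₂]
      simp [RingHom.mem_ker, φ₁, hi] at this

/-! ### The lattice of a lattice ideal -/

/-- An exponent in `ℕ^s`, regarded as a vector of `ℤ^s`. -/
def expVec (a : Fin s →₀ ℕ) : Fin s → ℤ := fun i => a i

theorem expVec_add (a b : Fin s →₀ ℕ) : expVec (a + b) = expVec a + expVec b := by
  ext i
  simp [expVec]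

theorem expVec_injective : Function.Injective (expVec (s := s)) := fun a b h => by
  ext i
  exact Int.ofNat_injective (congrFun h i)

theorem monomial_mul_binomial (a b c : Fin s →₀ ℕ) :
    (monomial c 1 * (monomial a 1 - monomial b 1) : MvPolynomial (Fin s) K) =
      monomial (c + a) 1 - monomial (c + b) 1 := by
  simp [mul_sub, monomial_mul]

/-- The lattice of all differences `a - b` in `ℤ^s` with `t^a - t^b ∈ I`. -/
def exponentLattice (I : Ideal (MvPolynomial (Fin s) K)) : AddSubgroup (Fin s → ℤ) where
  carrier := {u | ∃ a b : Fin s →₀ ℕ, (monomial a 1 - monomial b 1 : MvPolynomial (Fin s) K) ∈ I ∧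
    u = expVec a - expVec b}
  zero_mem' := ⟨0, 0, by simp, by simp⟩
  add_mem' := by
    rintro _ _ ⟨a, b, hab, rfl⟩ ⟨c, d, hcd, rfl⟩
    refine ⟨c + a, b + d, ?_, by rw [expVec_add, expVec_add]; abel⟩
    have h := I.add_mem (I.mul_mem_left (monomial c 1) hab) (I.mul_mem_left (monomial b 1) hcd)
    rwa [monomial_mul_binomial, monomial_mul_binomial, add_comm b c, sub_add_sub_cancel] at h
  neg_mem' := by
    rintro _ ⟨a, b, hab, rfl⟩
    exact ⟨b, a, by simpa using I.neg_mem hab, (neg_sub _ _)⟩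

theorem mem_of_monomial_mul_mem {I : Ideal (MvPolynomial (Fin s) K)}
    (hI : ∀ i : Fin s, Ideal.Quotient.mk I (X i) ∈ nonZeroDivisors (MvPolynomial (Fin s) K ⧸ I))
    (c : Fin s →₀ ℕ) {f : MvPolynomial (Fin s) K} (hf : monomial c 1 * f ∈ I) : f ∈ I := by
  have hc : Ideal.Quotient.mk I (monomial c 1) ∈ nonZeroDivisors (MvPolynomial (Fin s) K ⧸ I) := by
    rw [monomial_eq, map_one, one_mul, Finsupp.prod, map_prod]
    refine Submonoid.prod_mem _ fun i _ => ?_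
    rw [map_pow]
    exact Submonoid.pow_mem _ (hI i) _
  rw [← Ideal.Quotient.eq_zero_iff_mem, map_mul] at hf
  exact Ideal.Quotient.eq_zero_iff_mem.1 ((mem_nonZeroDivisors_iff_left.1 hc) _ hf)

/-- An element of the lattice may come from a different pair of exponents; the two binomials agree up
to monomial factors, which can be cancelled since variables are regular modulo `I`. -/
theorem sub_mem_exponentLattice_iff {I : Ideal (MvPolynomial (Fin s) K)}
    (hI : ∀ i : Fin s, Ideal.Quotient.mk I (X i) ∈ nonZeroDivisors (MvPolynomial (Fin s) K ⧸ I))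
    (a b : Fin s →₀ ℕ) : expVec a - expVec b ∈ exponentLattice I ↔
      (monomial a 1 - monomial b 1 : MvPolynomial (Fin s) K) ∈ I := by
  refine ⟨?_, fun h => ⟨a, b, h, rfl⟩⟩
  rintro ⟨c, d, hcd, h⟩
  rw [sub_eq_sub_iff_add_eq_add, ← expVec_add, ← expVec_add] at h
  have h := expVec_injective h
  refine mem_of_monomial_mul_mem hI d ?_
  rw [monomial_mul_binomial, add_comm d a, h, add_comm c b, add_comm d b, ← monomial_mul_binomial]
  exact I.mul_mem_left _ hcd

/-- If the two monomials had different degrees, each would lie in the graded ideal `I`, and cancelling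
variables would give `1 ∈ I`. -/
theorem degree_eq_of_binomial_mem {I : Ideal (MvPolynomial (Fin s) K)}
    (hgraded : I.IsHomogeneous (homogeneousSubmodule (Fin s) K)) (htop : I ≠ ⊤)
    (hI : ∀ i : Fin s, Ideal.Quotient.mk I (X i) ∈ nonZeroDivisors (MvPolynomial (Fin s) K ⧸ I))
    {a b : Fin s →₀ ℕ} (h : (monomial a 1 - monomial b 1 : MvPolynomial (Fin s) K) ∈ I) :
    a.degree = b.degree := by
  by_contra hne
  have ha : (monomial a 1 : MvPolynomial (Fin s) K) ∈ homogeneousSubmodule (Fin s) K a.degree :=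
    (mem_homogeneousSubmodule _ _).2 (isHomogeneous_monomial _ rfl)
  have hb : (monomial b 1 : MvPolynomial (Fin s) K) ∈ homogeneousSubmodule (Fin s) K b.degree :=
    (mem_homogeneousSubmodule _ _).2 (isHomogeneous_monomial _ rfl)
  have hm := hgraded a.degree h
  rw [DirectSum.decompose_sub, DirectSum.sub_apply, AddSubgroupClass.coe_sub,
    DirectSum.decompose_of_mem_same _ ha, DirectSum.decompose_of_mem_ne _ hb (Ne.symm hne),
    sub_zero, ← mul_one (monomial a 1)] at hm
  exact htop ((Ideal.eq_top_iff_one _).2 (mem_of_monomial_mul_mem hI a hm))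

theorem sum_expVec (a : Fin s →₀ ℕ) : ∑ i, expVec a i = a.degree := by
  simp [expVec, Finsupp.degree_eq_sum]

variable [NeZero s]

/-- The lattice of `I` enlarged by the basis vector `e_0`. Its quotient is dual to the subgroup of the
torus cut out by `I`, the vector `e_0` being killed by the normalisation of the coordinates. -/
def affineLattice (I : Ideal (MvPolynomial (Fin s) K)) : AddSubgroup (Fin s → ℤ) :=
  exponentLattice I ⊔ AddSubgroup.zmultiples (Pi.single 0 1)

theorem sub_mem_affineLattice_iff {I : Ideal (MvPolynomial (Fin s) K)}
    (hI : ∀ i : Fin s, Ideal.Quotient.mk I (X i) ∈ nonZeroDivisors (MvPolynomial (Fin s) K ⧸ I))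
    (hdeg : ∀ a b : Fin s →₀ ℕ,
      (monomial a 1 - monomial b 1 : MvPolynomial (Fin s) K) ∈ I → a.degree = b.degree)
    {a b : Fin s →₀ ℕ} (hab : a.degree = b.degree) :
    expVec a - expVec b ∈ affineLattice I ↔
      (monomial a 1 - monomial b 1 : MvPolynomial (Fin s) K) ∈ I := by
  rw [← sub_mem_exponentLattice_iff hI]
  refine ⟨fun h => ?_, fun h => AddSubgroup.mem_sup_left h⟩
  obtain ⟨u, hu, w, hw, huw⟩ := AddSubgroup.mem_sup.1 h
  obtain ⟨n, rfl⟩ := AddSubgroup.mem_zmultiples_iff.1 hw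
  have hsum := congrArg (fun w : Fin s → ℤ => ∑ i, w i) huw
  obtain ⟨c, d, hcd, rfl⟩ := hu
  have hn : n = 0 := by
    simpa [Finset.sum_add_distrib, sum_expVec, hab, hdeg c d hcd, ← Finset.mul_sum] using hsum
  rw [← huw, hn, zero_smul, add_zero]
  exact ⟨c, d, hcd, rfl⟩

/-- If the quotient were infinite, a nonzero functional on its free part would give a second grading
for which `I` is homogeneous, and the dimension of `S/I` would be at least `2`. -/
theorem finite_quotient_affineLattice {I : Ideal (MvPolynomial (Fin s) K)}
    (hbin : IsBinomialIdeal I)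
    (hdeg : ∀ a b : Fin s →₀ ℕ,
      (monomial a 1 - monomial b 1 : MvPolynomial (Fin s) K) ∈ I → a.degree = b.degree)
    (hdim : ringKrullDim (MvPolynomial (Fin s) K ⧸ I) < 2) :
    Finite ((Fin s → ℤ) ⧸ affineLattice I) := by
  set G := (Fin s → ℤ) ⧸ affineLattice I with hG
  have hfin : Module.Finite ℤ G :=
    Module.Finite.of_surjective (QuotientAddGroup.mk' (affineLattice I)).toIntLinearMap
      (QuotientAddGroup.mk'_surjective _)
  refine Module.finite_of_fg_torsion G ?_
  by_contra hne
  obtain ⟨g, hg⟩ : ∃ g : G, g ∉ Submodule.torsion ℤ G := by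
    by_contra! hall
    exact hne fun g => (Submodule.mem_torsion_iff g).1 (hall g)
  obtain ⟨φ, hφ⟩ : ∃ φ : Module.Dual ℤ (G ⧸ Submodule.torsion ℤ G),
      φ (Submodule.Quotient.mk g) ≠ 0 := by
    by_contra! hall
    exact hg ((Submodule.Quotient.mk_eq_zero _).1 ((Module.forall_dual_apply_eq_zero_iff ℤ _).1 hall))
  let ω : (Fin s → ℤ) →+ ℤ := (φ.comp (Submodule.mkQ _)).toAddMonoidHom.comp
    (QuotientAddGroup.mk' (affineLattice I))
  have hω : ∀ u ∈ affineLattice I, ω u = 0 := fun u hu => by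
    have : QuotientAddGroup.mk' (affineLattice I) u = 0 := (QuotientAddGroup.eq_zero_iff u).2 hu
    simp [ω, this]
  obtain ⟨u, hu⟩ := QuotientAddGroup.mk'_surjective (affineLattice I) g
  have hωu : ω u ≠ 0 := by
    change φ (Submodule.Quotient.mk (QuotientAddGroup.mk' (affineLattice I) u)) ≠ 0
    rwa [hu]
  let w : Fin s → ℤ := fun i => ω (Pi.single i 1)
  have hsum : ∀ x : Fin s → ℤ, ω x = ∑ i, x i * w i := fun x => by
    conv_lhs => rw [← Finset.univ_sum_single x]
    rw [map_sum]
    refine Finset.sum_congr rfl fun i _ => ?_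
    rw [← smul_eq_mul, ← map_zsmul, ← Pi.single_smul, smul_eq_mul, mul_one]
  have hw0 : w 0 = 0 := hω _ (AddSubgroup.mem_sup_right (AddSubgroup.mem_zmultiples _))
  obtain ⟨k, hk⟩ : ∃ k, w k ≠ 0 := by
    by_contra! hall
    exact hωu (by simp [hsum, hall])
  -- Subtracting the minimum makes the weights natural numbers; this is harmless because the
  -- binomials of `I` are homogeneous for the standard grading. Since `w 0 = 0` and `w k ≠ 0`, the
  -- weight is not constant, so the shifted weight is not identically zero.
  obtain ⟨i, hi⟩ := Finite.exists_min w
  let v : Fin s → ℕ := fun j => (w j - w i).toNat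
  have hv : ∀ j, (v j : ℤ) = w j - w i := fun j => Int.toNat_of_nonneg (sub_nonneg.2 (hi j))
  have hvi : v i = 0 := by simp [v]
  obtain ⟨j, hj⟩ : ∃ j, v j ≠ 0 := by
    by_contra! hall
    have hconst : ∀ j, w j = w i := fun j => by
      have := hv j
      rw [hall j] at this
      push_cast at this
      linarith
    exact hk (by rw [hconst, ← hconst 0, hw0])
  obtain ⟨B, hB, hIB⟩ := hbin
  refine absurd (two_le_ringKrullDim_of_weight v hvi hj hIB fun f hf => ?_) (not_le.2 hdim)
  obtain ⟨a, b, rfl⟩ := hB f hf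
  have hmem : (monomial a 1 - monomial b 1 : MvPolynomial (Fin s) K) ∈ I :=
    hIB ▸ Ideal.subset_span hf
  have hd := hdeg a b hmem
  refine ⟨a, b, rfl, hd, ?_⟩
  have h0 := hω _ (AddSubgroup.mem_sup_left ⟨a, b, hmem, rfl⟩)
  rw [map_sub, sub_eq_zero, hsum, hsum] at h0
  have h1 : ∑ k, expVec a k * w i = ∑ k, expVec b k * w i := by
    rw [← Finset.sum_mul, ← Finset.sum_mul, sum_expVec, sum_expVec, hd]
  have h2 : ∑ k, expVec a k * (w k - w i) = ∑ k, expVec b k * (w k - w i) := by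
    simp only [mul_sub, Finset.sum_sub_distrib, h0, h1]
  simp only [← hv, expVec] at h2
  exact_mod_cast h2

/-! ### Points of the torus from characters -/

/-- The torus point `[χ(e_0) : ⋯ : χ(e_{s-1})]` attached to a character `χ` of `ℤ^s / M`. -/
noncomputable def torusOfChar (M : AddSubgroup (Fin s → ℤ)) :
    (Multiplicative ((Fin s → ℤ) ⧸ M) →* Kˣ) →* projectiveTorus K s where
  toFun χ := torusMk (fun i => (χ (Multiplicative.ofAdd (Pi.single i 1 : Fin s → ℤ)) : K))
    fun _ => Units.ne_zero _
  map_one' := by simp [← torusMk_one]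
  map_mul' χ χ' := by simp [torusMk_mul]

theorem monomialHom_torusOfChar {M : AddSubgroup (Fin s → ℤ)} (hM : Pi.single 0 1 ∈ M)
    (χ : Multiplicative ((Fin s → ℤ) ⧸ M) →* Kˣ) (a : Fin s →₀ ℕ) :
    monomialHom a (torusOfChar M χ) =
      (χ (Multiplicative.ofAdd (expVec a : (Fin s → ℤ) ⧸ M)) : K) := by
  have h0 : ((Pi.single 0 1 : Fin s → ℤ) : (Fin s → ℤ) ⧸ M) = 0 :=
    (QuotientAddGroup.eq_zero_iff _).2 hM
  have ha : expVec a = ∑ i, a i • (Pi.single i 1 : Fin s → ℤ) := by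
    conv_lhs => rw [← Finset.univ_sum_single (expVec a)]
    refine Finset.sum_congr rfl fun i _ => ?_
    rw [← Pi.single_smul]
    simp [expVec]
  rw [monomialHom_apply, ha, ← QuotientAddGroup.mk'_apply, map_sum, ofAdd_sum, map_prod,
    Units.coe_prod]
  refine Finset.prod_congr rfl fun i _ => ?_
  rw [map_nsmul, ofAdd_nsmul, map_pow, Units.val_pow_eq_pow_val]
  have hi := coord_torusMk
    (fun i => (χ (Multiplicative.ofAdd ((Pi.single i 1 : Fin s → ℤ) : (Fin s → ℤ) ⧸ M)) : K))
    (fun _ => Units.ne_zero _) i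
  rw [h0, ofAdd_zero, map_one, Units.val_one, div_one] at hi
  exact congrArg (· ^ a i) hi

theorem exists_finite_subgroup_of_isLatticeIdeal [IsAlgClosed K] [CharZero K]
    {I : Ideal (MvPolynomial (Fin s) K)}
    (hgraded : I.IsHomogeneous (homogeneousSubmodule (Fin s) K))
    (hdim : ringKrullDim (MvPolynomial (Fin s) K ⧸ I) = 1) (hlat : IsLatticeIdeal I) :
    ∃ Y : Subgroup (projectiveTorus K s), Finite Y ∧
      I = vanishingIdeal (Subtype.val '' (Y : Set (projectiveTorus K s))) := by
  obtain ⟨hbin, hI⟩ := hlat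
  have htop : I ≠ ⊤ := by
    rintro rfl
    rw [ringKrullDim_eq_bot_of_subsingleton] at hdim
    simp at hdim
  have hdeg : ∀ a b : Fin s →₀ ℕ, (monomial a 1 - monomial b 1 : MvPolynomial (Fin s) K) ∈ I →
      a.degree = b.degree := fun a b => degree_eq_of_binomial_mem hgraded htop hI
  have hfin : Finite ((Fin s → ℤ) ⧸ affineLattice I) :=
    finite_quotient_affineLattice hbin hdeg (by rw [hdim]; norm_num)
  set G := (Fin s → ℤ) ⧸ affineLattice I
  have : NeZero (Monoid.exponent (Multiplicative G)) := ⟨Monoid.exponent_ne_zero_of_finite⟩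
  have hchar : Finite (Multiplicative G →* Kˣ) :=
    Finite.of_equiv _
      (CommGroup.monoidHom_mulEquiv_of_hasEnoughRootsOfUnity (Multiplicative G) K).some.symm.toEquiv
  let Y : Subgroup (projectiveTorus K s) := (torusOfChar (K := K) (affineLattice I)).range
  have h0 : (Pi.single 0 1 : Fin s → ℤ) ∈ affineLattice I :=
    AddSubgroup.mem_sup_right (AddSubgroup.mem_zmultiples _)
  have key : ∀ a b : Fin s →₀ ℕ, a.degree = b.degree →
      ((monomial a 1 - monomial b 1 : MvPolynomial (Fin s) K) ∈
        vanishingIdeal (Subtype.val '' (Y : Set (projectiveTorus K s))) ↔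
      (monomial a 1 - monomial b 1 : MvPolynomial (Fin s) K) ∈ I) := by
    intro a b hab
    rw [binomial_mem_vanishingIdeal_iff Y hab, ← sub_mem_affineLattice_iff hI hdeg hab,
      ← QuotientAddGroup.eq_iff_sub_mem]
    constructor
    · intro h
      by_contra hne
      obtain ⟨χ, hχ⟩ := CommGroup.exists_apply_ne_one_of_hasEnoughRootsOfUnity
        (Multiplicative G) K (a := Multiplicative.ofAdd ((expVec a : G) - (expVec b : G)))
        (by rwa [Ne, ofAdd_eq_one, sub_eq_zero])
      refine hχ ?_
      have := h _ ⟨χ, rfl⟩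
      rw [monomialHom_torusOfChar h0, monomialHom_torusOfChar h0, Units.val_inj] at this
      rw [ofAdd_sub, map_div, this, div_self']
    · rintro h _ ⟨χ, rfl⟩
      rw [monomialHom_torusOfChar h0, monomialHom_torusOfChar h0, h]
  refine ⟨Y, (Set.finite_range _).to_subtype, le_antisymm ?_ ?_⟩
  · obtain ⟨B, hB, hIB⟩ := hbin
    conv_lhs => rw [hIB]
    refine Ideal.span_le.2 fun f hf => ?_
    have hfI : f ∈ I := hIB ▸ Ideal.subset_span hf
    obtain ⟨a, b, rfl⟩ := hB f hf
    exact (key a b (hdeg a b hfI)).2 hfI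
  · exact vanishingIdeal_le_of_binomials Y fun a b hab => (key a b hab).1

end LatticeDimOne

theorem proposition3p12 {K : Type*} [Field K] [IsAlgClosed K] [CharZero K] (s : ℕ) [NeZero s]
    (I : Ideal (MvPolynomial (Fin s) K))
    (hgraded : I.IsHomogeneous (MvPolynomial.homogeneousSubmodule (Fin s) K))
    (hdim : ringKrullDim (MvPolynomial (Fin s) K ⧸ I) = 1) :
    LatticeDimOne.IsLatticeIdeal I ↔
      ∃ Y : Subgroup (LatticeDimOne.projectiveTorus K s), Finite Y ∧
        I = LatticeDimOne.vanishingIdeal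
          (Subtype.val '' (Y : Set (LatticeDimOne.projectiveTorus K s))) := by
  refine ⟨LatticeDimOne.exists_finite_subgroup_of_isLatticeIdeal hgraded hdim, ?_⟩
  rintro ⟨Y, -, rfl⟩
  exact LatticeDimOne.isLatticeIdeal_vanishingIdeal Y
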